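/- Let $D\ge 2$. For $d=1,\dots,D$ let $M_d\in\mathbb{N}$, let $\varphi^{(d)}:\mathbb{R}\to\mathbb{R}^{M_d}$ be a function and let $\Lambda^{(d)}\in\mathbb{R}^{M_d\times M_d}$. For inner ranks $R_1,\dots,R_{D-1}\ge 1$, with $R_0=R_D=1$, a tensor train has cores $\mathcal{W}^{(d)}\in\mathbb{R}^{R_{d-1}\times M_d\times R_d}$, $d=1,\dots,D$, and represents the tensor with entries $$w_{m_1,\dots,m_D}=\sum_{r_0=1}^{R_0}\cdots\sum_{r_D=1}^{R_D}\prod_{d=1}^D w^{(d)}_{r_{d-1},m_d,r_d}.$$ The TT-constrained kernel machine is, for $x\in\mathbb{R}^D$, $$f_{\mathrm{TT}}(x)=\sum_{m_1=1}^{M_1}\cdots\sum_{m_D=1}^{M_D}\Big(\prod_{d=1}^D\varphi^{(d)}_{m_d}(x_d)\Big)\,w_{m_1,\dots,m_D}.$$ Suppose that, for every choice of the inner ranks, the cores are random, the fibers $\mathbf{W}^{(d)}_{r_{d-1},:,r_d}\in\mathbb{R}^{M_d}$ of all the cores are mutually independent, the fibers of each single core are identically distributed, and they are square integrable with $$\mathbb{E}\big[\mathbf{W}^{(d)}_{r_{d-1},:,r_d}\big]=0,\qquad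 \mathbb{E}\big[\mathbf{W}^{(d)}_{r_{d-1},:,r_d}{\mathbf{W}^{(d)}_{r_{d-1},:,r_d}}^{\mathrm T}\big]=\frac{1}{\sqrt{R_{d-1}R_d}}\,\Lambda^{(d)},$$ where the ranks enter only through this scaling: for each $d$ the law of $(R_{d-1}R_d)^{1/4}\,\mathbf{W}^{(d)}_{r_{d-1},:,r_d}$ is the same for all ranks. Then there is a zero-mean Gaussian process $Y$ on $\mathbb{R}^D$ with covariance $$\mathbb{E}[Y(x)Y(x')]=\prod_{d=1}^D \varphi^{(d)}(x_d)^{\mathrm T}\Lambda^{(d)}\varphi^{(d)}(x'_d)$$ such that $f_{\mathrm{TT}}$ converges to $Y$ in distribution in the successive limit $R_1\to\infty$, then $R_2\to\infty$, …, then $R_{D-1}\to\infty$. That is, for all finitely many inputs $x_1,\dots,x_N\in\mathbb{R}^D$, the joint law of $(f_{\mathrm{TT}}(x_1),\dots,f_{\mathrm{TT}}(x_N))$ converges weakly, as $R_1\to\infty$ with $R_2,\dots,R_{D-1}$ fixed, to some law; these laws converge weakly as $R_2\to\infty$ with $R_3,\dots,R_{D-1}$ fixed; and so on, and the last limit, as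 $R_{D-1}\to\infty$, is the law of $(Y(x_1),\dots,Y(x_N))$. -/

import Mathlib

open MeasureTheory ProbabilityTheory Filter Topology

section Tensors

/-- The cores of a tensor train with `D` modes, mode sizes `M` and ranks `R 0, …, R D`.
`W d i j` is the fiber of the `d`-th core at the rank indices `i` (left) and `j` (right);
it is a vector indexed by the mode. -/
abbrev TTCores (D : ℕ) (M : Fin D → ℕ) (R : Fin (D + 1) → ℕ+) : Type :=
  (d : Fin D) → Fin (R d.castSucc : ℕ) → Fin (R d.succ : ℕ) → Fin (M d) → ℝ

/-- The tensor that has the given tensor train cores: a sum over all rank indices. -/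
def ttTensor {D : ℕ} {M : Fin D → ℕ} {R : Fin (D + 1) → ℕ+} (W : TTCores D M R)
    (m : (d : Fin D) → Fin (M d)) : ℝ :=
  ∑ r : (k : Fin (D + 1)) → Fin (R k : ℕ), ∏ d : Fin D, W d (r d.castSucc) (r d.succ) (m d)

/-- The tensorized Kronecker product basis functions: a rank-one tensor. -/
def basisTensor {D : ℕ} {M : Fin D → ℕ} (φ : (d : Fin D) → ℝ → Fin (M d) → ℝ)
    (x : Fin D → ℝ) (m : (d : Fin D) → Fin (M d)) : ℝ :=
  ∏ d : Fin D, φ d (x d) (m d)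

/-- The Frobenius inner product of two tensors. -/
def frobeniusInner {D : ℕ} {M : Fin D → ℕ} (A B : ((d : Fin D) → Fin (M d)) → ℝ) : ℝ :=
  ∑ m : (d : Fin D) → Fin (M d), A m * B m

/-- The tensor-train-constrained kernel machine. -/
def ttMachine {D : ℕ} {M : Fin D → ℕ} {R : Fin (D + 1) → ℕ+}
    (φ : (d : Fin D) → ℝ → Fin (M d) → ℝ) (W : TTCores D M R) (x : Fin D → ℝ) : ℝ :=
  frobeniusInner (basisTensor φ x) (ttTensor W)

/-- All ranks `(1, R₁, …, Rₙ, 1)` of a tensor train with `n + 1` modes, from the `n` inner ones. -/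
def ttRanks {n : ℕ} (R : Fin n → ℕ+) : Fin (n + 1 + 1) → ℕ+ :=
  Fin.cons 1 (Fin.snoc (α := fun _ => ℕ+) R 1)

/-- The product kernel `∏ d, φ d (x d)ᵀ Λ d φ d (x' d)`. -/
def productKernel {D : ℕ} {M : Fin D → ℕ} (φ : (d : Fin D) → ℝ → Fin (M d) → ℝ)
    (Λ : (d : Fin D) → Matrix (Fin (M d)) (Fin (M d)) ℝ) (x x' : Fin D → ℝ) : ℝ :=
  ∏ d : Fin D, φ d (x d) ⬝ᵥ (Λ d).mulVec (φ d (x' d))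

end Tensors

section Probability

/-- The random cores `W` have mutually independent fibers, the fibers of each single core are
identically distributed, and each fiber of core `d` is square integrable with mean zero and
second moment matrix `(R_{d-1} R_d)^{-1/2} Λ d`. -/
structure IsTTPrior {D : ℕ} {M : Fin D → ℕ} {R : Fin (D + 1) → ℕ+}
    (Λ : (d : Fin D) → Matrix (Fin (M d)) (Fin (M d)) ℝ)
    {Ω : Type*} [MeasurableSpace Ω] (P : Measure Ω)
    (W : (d : Fin D) → Fin (R d.castSucc : ℕ) → Fin (R d.succ : ℕ) → Ω → Fin (M d) → ℝ) :
    Prop where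
  indep : iIndepFun
    (fun (p : (d : Fin D) × (Fin (R d.castSucc : ℕ) × Fin (R d.succ : ℕ))) =>
      W p.1 p.2.1 p.2.2) P
  identDistrib : ∀ d i j i' j', IdentDistrib (W d i j) (W d i' j') P P
  memLp : ∀ d i j m, MemLp (fun ω => W d i j ω m) 2 P
  mean_eq_zero : ∀ d i j m, ∫ ω, W d i j ω m ∂P = 0
  second_moment : ∀ d i j m m', ∫ ω, W d i j ω m * W d i j ω m' ∂P =
    1 / Real.sqrt ((R d.castSucc : ℝ) * (R d.succ : ℝ)) * Λ d m m'

/-- The law of a real process `X` at the finitely many points `t 0, …, t (N - 1)`. -/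
noncomputable def fddLaw {Ω T : Type*} [MeasurableSpace Ω] (P : Measure Ω) [IsProbabilityMeasure P]
    (X : T → Ω → ℝ) (hX : ∀ t, AEMeasurable (X t) P) {N : ℕ} (t : Fin N → T) :
    ProbabilityMeasure (Fin N → ℝ) :=
  ⟨P.map (fun ω k => X (t k) ω),
    Measure.isProbabilityMeasure_map (aemeasurable_pi_lambda _ fun k => hX (t k))⟩

/-- The model with random cores is a random variable at each input. -/
theorem IsTTPrior.aemeasurable_ttMachine {D : ℕ} {M : Fin D → ℕ} {R : Fin (D + 1) → ℕ+}
    {Λ : (d : Fin D) → Matrix (Fin (M d)) (Fin (M d)) ℝ}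
    {Ω : Type*} [MeasurableSpace Ω] {P : Measure Ω}
    {W : (d : Fin D) → Fin (R d.castSucc : ℕ) → Fin (R d.succ : ℕ) → Ω → Fin (M d) → ℝ}
    (h : IsTTPrior Λ P W) (φ : (d : Fin D) → ℝ → Fin (M d) → ℝ) (x : Fin D → ℝ) :
    AEMeasurable (fun ω => ttMachine φ (fun d i j => W d i j ω) x) P := by
  unfold ttMachine frobeniusInner ttTensor
  refine Finset.aemeasurable_fun_sum _ fun m _ => AEMeasurable.const_mul ?_ _
  refine Finset.aemeasurable_fun_sum _ fun r _ => Finset.aemeasurable_fun_prod _ fun d _ => ?_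
  exact (h.memLp d _ _ (m d)).aestronglyMeasurable.aemeasurable

/-- `a` is the successive limit of `F (R₁, …, Rₙ)`: first `R₁ → ∞` for all fixed values of
`R₂, …, Rₙ`, then `R₂ → ∞` for all fixed values of `R₃, …, Rₙ`, and so on up to `Rₙ → ∞`.
All the inner limits are required to exist. -/
def IsSuccessiveLimit {E : Type*} [TopologicalSpace E] :
    (n : ℕ) → ((Fin n → ℕ+) → E) → E → Prop
  | 0, F, a => F Fin.elim0 = a
  | n + 1, F, a => ∃ G : (Fin n → ℕ+) → E,
      (∀ s : Fin n → ℕ+, Tendsto (fun r : ℕ+ => F (Fin.cons r s)) atTop (𝓝 (G s))) ∧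
        IsSuccessiveLimit n G a

end Probability

/-! Fix inputs `x 0, …, x (N - 1)`. Evaluating the feature map of a mode at all of them turns a
fiber into a vector of `Fin N → ℝ`, and with pointwise multiplication this space is a commutative
ring. Over that ring the machine is a product of matrices, the row of ones times one random matrix
per core (`ttMachine_eq_contract`), so all finite-dimensional laws can be studied by multiplying
from left to right.

Since the outer rank is 1, the first core is a row of `R₁` independent entries, each distributed as
`R₁^(-1/4)` times a fixed centered vector with covariance `C`. Multiplying by the next core, scaled
by `(R₁ R₂)^(-1/4)` with unscaled covariance `K`, gives `R₁^(-1/2)` times a sum of `R₁` i.i.d.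
summands in `Fin R₂ → Fin N → ℝ`. The columns of one summand share a factor, so they are dependent,
but they are uncorrelated. The central limit theorem therefore gives a Gaussian limit with
uncorrelated, hence independent, columns: again an i.i.d. row with scaling `R₂^(-1/4)`, now with the
entrywise product of `C` and `K` as covariance (`tendsto_stepLaw_iidLaw`).

The remaining cores do not involve `R₁` and are contracted continuously, so the limit passes through
them (`continuous_ttLaw`). What is left is a tensor train of the same kind with one core fewer, and
induction finishes. The last rank is 1, so the final law is a single Gaussian vector whose
covariance is the product over the modes. At least one inner rank is needed: without any limit the
first core need not be Gaussian. -/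

/-! ### Weak convergence in finite dimension. -/

section CentralLimit

variable {E : Type*} [NormedAddCommGroup E] [NormedSpace ℝ E] [FiniteDimensional ℝ E]
  [MeasurableSpace E] [BorelSpace E]

/-- The **Cramér–Wold device**. -/
theorem tendsto_of_forall_tendsto_map_dual {μ : ℕ → ProbabilityMeasure E}
    {μ₀ : ProbabilityMeasure E}
    (h : ∀ L : StrongDual ℝ E,
      Tendsto (fun n => (μ n).map (f := L) L.continuous.measurable.aemeasurable) atTop
        (𝓝 (μ₀.map (f := L) L.continuous.measurable.aemeasurable))) :
    Tendsto μ atTop (𝓝 μ₀) := by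
  obtain ⟨e⟩ : Nonempty (E ≃L[ℝ] EuclideanSpace ℝ (Fin (Module.finrank ℝ E))) := ⟨toEuclidean⟩
  have key : Tendsto (fun n => (μ n).map (f := e) e.continuous.measurable.aemeasurable) atTop
      (𝓝 (μ₀.map (f := e) e.continuous.measurable.aemeasurable)) := by
    refine ProbabilityMeasure.tendsto_iff_tendsto_charFun.2 fun t => ?_
    -- The characteristic function at `t` is that of the one-dimensional marginal along `⟪t, ·⟫`,
    -- taken at 1.
    obtain ⟨L, hL⟩ : ∃ L : StrongDual ℝ E, ∀ ν : ProbabilityMeasure E,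
        charFun ((ν : Measure E).map e) t = charFun ((ν : Measure E).map L) 1 := by
      refine ⟨(InnerProductSpace.toDualMap ℝ _ t).comp (e : E →L[ℝ] _), fun ν => ?_⟩
      rw [charFun_eq_charFunDual_toDualMap, charFunDual_eq_charFun_map_one,
        Measure.map_map (by fun_prop) (by fun_prop)]
      rfl
    simp only [ProbabilityMeasure.toMeasure_map, hL]
    exact ProbabilityMeasure.tendsto_iff_tendsto_charFun.1 (h L) 1
  have h2 := ((ProbabilityMeasure.continuous_map e.symm.continuous).tendsto _).comp key
  have h3 : ∀ ν : ProbabilityMeasure E,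
      (ν.map (f := e) e.continuous.measurable.aemeasurable).map (f := e.symm)
        e.symm.continuous.measurable.aemeasurable = ν := by
    intro ν
    apply Subtype.ext
    change ((ν : Measure E).map e).map e.symm = ν
    rw [Measure.map_map (by fun_prop) (by fun_prop)]
    simp
  simpa only [Function.comp_def, h3] using h2

/-- The **central limit theorem** in finite dimension. -/
theorem tendsto_map_inv_sqrt_smul_sum {Ω : Type*} [MeasurableSpace Ω] {P : Measure Ω}
    [IsProbabilityMeasure P] {X : ℕ → Ω → E} (hX : ∀ i, Measurable (X i))
    (hindep : iIndepFun X P) (hident : ∀ i, IdentDistrib (X i) (X 0) P P)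
    (hL2 : ∀ L : StrongDual ℝ E, MemLp (fun ω => L (X 0 ω)) 2 P)
    (hmean : ∀ L : StrongDual ℝ E, ∫ ω, L (X 0 ω) ∂P = 0)
    {γ : ProbabilityMeasure E} (hγ : IsGaussian (γ : Measure E))
    (hγmean : ∀ L : StrongDual ℝ E, ∫ x, L x ∂(γ : Measure E) = 0)
    (hγvar : ∀ L : StrongDual ℝ E, Var[L; (γ : Measure E)] = Var[fun ω => L (X 0 ω); P])
    {μ : ℕ → ProbabilityMeasure E}
    (hμ : ∀ n : ℕ, (μ n : Measure E) =
      P.map (fun ω => (√(n : ℝ))⁻¹ • ∑ k ∈ Finset.range n, X k ω)) :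
    Tendsto μ atTop (𝓝 γ) := by
  refine tendsto_of_forall_tendsto_map_dual fun L => ?_
  have hlaw : HasLaw L (gaussianReal 0 (Var[fun ω => L (X 0 ω); P]).toNNReal)
      (γ : Measure E) := by
    refine ⟨L.continuous.measurable.aemeasurable, ?_⟩
    rw [hγ.map_eq_gaussianReal L, hγmean, hγvar]
  -- The scalar theorem subtracts the means, which vanish by `hmean`.
  have := (tendstoInDistribution_inv_sqrt_mul_sum_sub (X := fun i ω => L (X i ω)) hlaw (hL2 L)
    (hindep.comp (fun _ => L) fun _ => L.continuous.measurable)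
    (fun i => (hident i).comp L.continuous.measurable)).tendsto
  refine this.congr fun n => Subtype.ext ?_
  symm
  change (μ n : Measure E).map L = P.map _
  have hm : Measurable (fun ω => (√(n : ℝ))⁻¹ • ∑ k ∈ Finset.range n, X k ω) :=
    (Finset.measurable_fun_sum _ fun i _ => hX i).const_smul _
  rw [hμ, Measure.map_map L.continuous.measurable hm]
  congr 1
  ext ω
  simp [hmean]

end CentralLimit

/-! ### Calculus of second moments, and centered Gaussian measures. -/

section SecondMoments

/-- The real random variables `X i` are square integrable and centered, with second moments
`C i j`. -/
structure HasSecondMoments {Ω : Type*} [MeasurableSpace Ω] {ι : Type*} (P : Measure Ω)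
    (X : ι → Ω → ℝ) (C : ι → ι → ℝ) : Prop where
  memLp : ∀ i, MemLp (X i) 2 P
  mean : ∀ i, ∫ ω, X i ω ∂P = 0
  second : ∀ i j, ∫ ω, X i ω * X j ω ∂P = C i j

namespace HasSecondMoments

variable {Ω : Type*} [MeasurableSpace Ω] {ι : Type*} {P : Measure Ω} {X : ι → Ω → ℝ}
  {C : ι → ι → ℝ}

theorem integrable_mul (h : HasSecondMoments P X C) (i j : ι) :
    Integrable (fun ω => X i ω * X j ω) P :=
  (h.memLp i).integrable_mul (h.memLp j)

/-- Linear combinations of square integrable centered random variables. -/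
theorem linear [IsFiniteMeasure P] [Fintype ι] {κ : Type*} (h : HasSecondMoments P X C)
    (a : κ → ι → ℝ) :
    HasSecondMoments P (fun k ω => ∑ i, a k i * X i ω)
      (fun k l => ∑ i, ∑ j, a k i * a l j * C i j) where
  memLp k := memLp_finsetSum _ fun i _ => (h.memLp i).const_mul _
  mean k := by
    rw [integral_finsetSum _ fun i _ => ((h.memLp i).integrable (by norm_num)).const_mul _]
    simp [integral_const_mul, h.mean]
  second k l := by
    have : ∀ ω, (∑ i, a k i * X i ω) * (∑ j, a l j * X j ω) =
        ∑ i, ∑ j, a k i * a l j * (X i ω * X j ω) := fun ω => by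
      rw [Finset.sum_mul_sum]
      exact Finset.sum_congr rfl fun i _ => Finset.sum_congr rfl fun j _ => by ring
    simp only [this]
    rw [integral_finsetSum _ fun i _ => integrable_finsetSum _ fun j _ =>
      (h.integrable_mul i j).const_mul _]
    refine Finset.sum_congr rfl fun i _ => ?_
    rw [integral_finsetSum _ fun j _ => (h.integrable_mul i j).const_mul _]
    exact Finset.sum_congr rfl fun j _ => by rw [integral_const_mul, h.second]

theorem const_mul (h : HasSecondMoments P X C) (c : ℝ) :
    HasSecondMoments P (fun i ω => c * X i ω) (fun i j => c ^ 2 * C i j) where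
  memLp i := (h.memLp i).const_mul c
  mean i := by rw [integral_const_mul, h.mean, mul_zero]
  second i j := by
    rw [← h.second, ← integral_const_mul]
    exact integral_congr_ae (.of_forall fun ω => by ring)

theorem variance_sum [IsFiniteMeasure P] [Fintype ι] (h : HasSecondMoments P X C) (c : ι → ℝ) :
    Var[fun ω => ∑ i, c i * X i ω; P] = ∑ i, ∑ j, c i * c j * C i j := by
  have h' := h.linear (fun _ : Unit => c)
  rw [variance_of_integral_eq_zero (h'.memLp ()).aestronglyMeasurable.aemeasurable (h'.mean ()),
    ← h'.second () ()]
  exact integral_congr_ae (.of_forall fun ω => by simp [sq])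

/-- The quadratic form of `C` at `x` is the variance of `∑ i, x i * X i`. -/
theorem posSemidef [IsFiniteMeasure P] [Fintype ι] (h : HasSecondMoments P X C) :
    (Matrix.of C).PosSemidef := by
  refine Matrix.PosSemidef.of_dotProduct_mulVec_nonneg ?_ fun x => ?_
  · ext i j
    simp only [Matrix.conjTranspose_apply, Matrix.of_apply, star_trivial]
    rw [← h.second j i, ← h.second i j]
    exact integral_congr_ae (.of_forall fun ω => mul_comm _ _)
  · have := variance_nonneg (fun ω => ∑ i, x i * X i ω) P
    rw [h.variance_sum] at this
    refine this.trans_eq ?_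
    simp only [dotProduct, Matrix.mulVec, Matrix.of_apply, Pi.star_apply, star_trivial,
      Finset.mul_sum]
    exact Finset.sum_congr rfl fun i _ => Finset.sum_congr rfl fun j _ => by ring

theorem map_iff {Y : Ω → ι → ℝ} (hY : AEMeasurable Y P) :
    HasSecondMoments (P.map Y) (fun i x => x i) C ↔ HasSecondMoments P (fun i ω => Y ω i) C := by
  have hm : ∀ i, AEStronglyMeasurable (fun x : ι → ℝ => x i) (P.map Y) := fun i =>
    (measurable_pi_apply i).aestronglyMeasurable
  have h1 : ∀ i, ∫ x, x i ∂(P.map Y) = ∫ ω, Y ω i ∂P := fun i => integral_map hY (hm i)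
  have h2 : ∀ i j, ∫ x, x i * x j ∂(P.map Y) = ∫ ω, Y ω i * Y ω j ∂P := fun i j =>
    integral_map hY ((hm i).mul (hm j))
  have h3 : ∀ i, MemLp (fun x : ι → ℝ => x i) 2 (P.map Y) ↔ MemLp (fun ω => Y ω i) 2 P :=
    fun i => memLp_map_measure_iff (hm i) hY
  exact ⟨fun h => ⟨fun i => (h3 i).1 (h.memLp i), fun i => (h1 i) ▸ h.mean i,
    fun i j => (h2 i j) ▸ h.second i j⟩, fun h => ⟨fun i => (h3 i).2 (h.memLp i),
    fun i => (h1 i).trans (h.mean i), fun i j => (h2 i j).trans (h.second i j)⟩⟩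

theorem comp_measurePreserving {Ω' : Type*} [MeasurableSpace Ω'] {P' : Measure Ω'} {f : Ω' → Ω}
    (h : HasSecondMoments P X C) (hf : MeasurePreserving f P' P) :
    HasSecondMoments P' (fun i ω => X i (f ω)) C where
  memLp i := (h.memLp i).comp_measurePreserving hf
  mean i := by
    have := (h.memLp i).aestronglyMeasurable
    rw [← h.mean i, ← hf.map_eq, integral_map hf.aemeasurable (hf.map_eq.symm ▸ this)]
  second i j := by
    have := (h.integrable_mul i j).aestronglyMeasurable
    rw [← h.second i j, ← hf.map_eq, integral_map hf.aemeasurable (hf.map_eq.symm ▸ this)]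

/-- Products of the members of two independent families. -/
theorem mul_prod {Ω' : Type*} [MeasurableSpace Ω'] {ι' : Type*} {P' : Measure Ω'}
    {X' : ι' → Ω' → ℝ} {C' : ι' → ι' → ℝ} [IsProbabilityMeasure P] [IsProbabilityMeasure P']
    (h : HasSecondMoments P X C) (h' : HasSecondMoments P' X' C') (f : ι' → ι) :
    HasSecondMoments (P.prod P') (fun i ω => X (f i) ω.1 * X' i ω.2)
      (fun i j => C (f i) (f j) * C' i j) where
  memLp i := by
    have hm : AEStronglyMeasurable (fun ω : Ω × Ω' => X (f i) ω.1 * X' i ω.2) (P.prod P') :=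
      (h.memLp _).aestronglyMeasurable.comp_fst.mul (h'.memLp _).aestronglyMeasurable.comp_snd
    rw [memLp_two_iff_integrable_sq hm]
    refine ((h.memLp (f i)).integrable_sq.mul_prod (h'.memLp i).integrable_sq).congr
      (.of_forall fun ω => ?_)
    simp [mul_pow]
  mean i := by rw [integral_prod_mul (X (f i)) (X' i), h.mean, zero_mul]
  second i j := by
    rw [← h.second, ← h'.second, ← integral_prod_mul]
    exact integral_congr_ae (.of_forall fun ω => by ring)

/-- Independent copies of a family. -/
theorem pi {κ : Type*} [Fintype κ] [DecidableEq κ] [IsProbabilityMeasure P]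
    (h : HasSecondMoments P X C) :
    HasSecondMoments (Measure.pi fun _ : κ => P) (fun (p : κ × ι) ω => X p.2 (ω p.1))
      (fun p q => if p.1 = q.1 then C p.2 q.2 else 0) where
  memLp p := (h.memLp p.2).comp_measurePreserving (measurePreserving_eval _ p.1)
  mean p := by
    rw [integral_comp_eval (μ := fun _ : κ => P) (i := p.1) (h.memLp p.2).aestronglyMeasurable, h.mean]
  second p q := by
    obtain ⟨j, k⟩ := p
    obtain ⟨j', k'⟩ := q
    by_cases hj : j = j'
    · subst hj
      simp only [if_true]
      rw [← h.second, integral_comp_eval (μ := fun _ : κ => P) (i := j)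
        (f := fun ω => X k ω * X k' ω) (h.integrable_mul _ _).aestronglyMeasurable]
    · simp only [if_neg hj]
      -- Distinct copies are independent, so the mixed moment is a product of means, which is zero.
      have hi : IndepFun (fun ω : κ → Ω => X k (ω j)) (fun ω => X k' (ω j'))
          (Measure.pi fun _ : κ => P) := by
        have := (iIndepFun_pi (μ := fun _ : κ => P) (X := fun _ => id)
          (fun _ => aemeasurable_id)).indepFun hj
        refine this.comp₀ (φ := X k) (ψ := X k')
          (measurable_pi_apply j).aemeasurable (measurable_pi_apply j').aemeasurable ?_ ?_
        · simpa [Measure.pi_map_eval] using (h.memLp k).aestronglyMeasurable.aemeasurable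
        · simpa [Measure.pi_map_eval] using (h.memLp k').aestronglyMeasurable.aemeasurable
      rw [hi.integral_fun_mul_eq_mul_integral
        ((h.memLp k).comp_measurePreserving (measurePreserving_eval _ j)).aestronglyMeasurable
        ((h.memLp k').comp_measurePreserving (measurePreserving_eval _ j')).aestronglyMeasurable,
        integral_comp_eval (μ := fun _ : κ => P) (i := j) (h.memLp k).aestronglyMeasurable, h.mean, zero_mul]

end HasSecondMoments

variable {ι : Type*} [Fintype ι]

/-- Independent Gaussian coordinates are jointly Gaussian; this makes the i.i.d. limit row a
Gaussian measure. -/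
theorem isGaussian_pi {κ : Type*} [Fintype κ] {E : Type*} [NormedAddCommGroup E]
    [NormedSpace ℝ E] [MeasurableSpace E] [BorelSpace E] [CompleteSpace E]
    [SecondCountableTopology E] (μ : κ → Measure E) [∀ k, IsGaussian (μ k)] :
    IsGaussian (Measure.pi μ) := by
  have := (iIndepFun_pi (μ := μ) (X := fun _ => id) (fun _ => aemeasurable_id)).hasGaussianLaw
    (fun i => ⟨by
      change IsGaussian ((Measure.pi μ).map (fun ω => ω i))
      rw [(measurePreserving_eval μ i).map_eq]; infer_instance⟩)
  have h := this.isGaussian_map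
  simpa using h

/-- There is a centered Gaussian measure with any given positive semidefinite covariance. -/
theorem exists_isGaussian_hasSecondMoments {C : ι → ι → ℝ} (hC : (Matrix.of C).PosSemidef) :
    ∃ γ : ProbabilityMeasure (ι → ℝ), IsGaussian (γ : Measure (ι → ℝ)) ∧
      HasSecondMoments (γ : Measure (ι → ℝ)) (fun i x => x i) C := by
  classical
  set μ := multivariateGaussian (0 : EuclideanSpace ℝ ι) (Matrix.of C)
  set e := PiLp.continuousLinearEquiv 2 ℝ (fun _ : ι => ℝ)
  have hm : AEMeasurable e μ := e.continuous.measurable.aemeasurable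
  refine ⟨⟨μ.map e, Measure.isProbabilityMeasure_map hm⟩, ?_, ?_⟩
  · change IsGaussian (μ.map e)
    infer_instance
  · change HasSecondMoments (μ.map e) _ _
    rw [HasSecondMoments.map_iff hm]
    have hmean : ∀ i, ∫ x, x i ∂μ = 0 := fun i => by
      have := ContinuousLinearMap.integral_comp_id_comm (μ := μ) IsGaussian.integrable_id
        (EuclideanSpace.proj i : EuclideanSpace ℝ ι →L[ℝ] ℝ)
      simpa [μ] using this
    have hL : ∀ i, MemLp (fun x : EuclideanSpace ℝ ι => x i) 2 μ := fun i =>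
      (EuclideanSpace.proj i : EuclideanSpace ℝ ι →L[ℝ] ℝ).comp_memLp' IsGaussian.memLp_two_id
    refine ⟨hL, hmean, fun i j => ?_⟩
    have := covariance_eval_multivariateGaussian (μ := (0 : EuclideanSpace ℝ ι)) hC i j
    rw [covariance_eq_sub (hL i) (hL j)] at this
    rw [hmean i, hmean j, mul_zero, sub_zero] at this
    exact this

theorem exists_dual_eq_sum (L : StrongDual ℝ (ι → ℝ)) :
    ∃ c : ι → ℝ, (L : (ι → ℝ) → ℝ) = fun x => ∑ i, c i * x i := by
  classical
  refine ⟨fun i => L (Pi.single i 1), funext fun x => ?_⟩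
  conv_lhs => rw [← Finset.univ_sum_single x]
  rw [map_sum]
  refine Finset.sum_congr rfl fun i _ => ?_
  rw [show Pi.single i (x i) = x i • (Pi.single i (1 : ℝ) : ι → ℝ) by
    rw [← Pi.single_smul]; simp]
  simp [mul_comm]

theorem exists_dual_eq_sum_prod {κ : Type*} [Fintype κ] (L : StrongDual ℝ (κ → ι → ℝ)) :
    ∃ c : κ × ι → ℝ, (L : (κ → ι → ℝ) → ℝ) = fun x => ∑ p : κ × ι, c p * x p.1 p.2 := by
  obtain ⟨c, hc⟩ := exists_dual_eq_sum (L.comp (ContinuousLinearMap.pi fun j : κ =>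
    ContinuousLinearMap.pi fun k : ι => ContinuousLinearMap.proj (j, k)))
  exact ⟨c, funext fun x => congrFun hc fun p => x p.1 p.2⟩

/-- A centered Gaussian measure is determined by its covariance. -/
theorem IsGaussian.eq_of_hasSecondMoments {μ ν : Measure (ι → ℝ)} (hμ : IsGaussian μ)
    (hν : IsGaussian ν) {C : ι → ι → ℝ} (hμC : HasSecondMoments μ (fun i x => x i) C)
    (hνC : HasSecondMoments ν (fun i x => x i) C) : μ = ν := by
  refine Measure.ext_of_charFunDual ?_
  ext L
  obtain ⟨c, hc⟩ := exists_dual_eq_sum L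
  have h : ∀ ρ : Measure (ι → ℝ), IsGaussian ρ → HasSecondMoments ρ (fun i x => x i) C →
      ∫ x, L x ∂ρ = 0 ∧ Var[L; ρ] = ∑ i, ∑ j, c i * c j * C i j := fun ρ hρ hC => by
    rw [hc]
    exact ⟨(hC.linear fun _ : Unit => c).mean (), hC.variance_sum c⟩
  rw [hμ.charFunDual_eq, hν.charFunDual_eq]
  simp only [integral_complex_ofReal, (h μ hμ hμC).1, (h μ hμ hμC).2, (h ν hν hνC).1,
    (h ν hν hνC).2]

end SecondMoments

/-! ### Tensor trains as matrix products over a commutative ring. -/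

section Contraction

/-- The row vector `h` times the matrix `U`. -/
def rowMul {A : Type*} [CommRing A] {m k : ℕ} (h : Fin m → A) (U : Fin m × Fin k → A) (j : Fin k) :
    A :=
  ∑ i, h i * U (i, j)

/-- Multiply the row vector `h` by the matrices `U 0, …, U (D - 1)` in turn and sum the entries of
the result. -/
def contract {A : Type*} [CommRing A] : (D : ℕ) → (R : Fin (D + 1) → ℕ+) →
    (Fin (R 0 : ℕ) → A) →
    ((d : Fin D) → Fin (R d.castSucc : ℕ) × Fin (R d.succ : ℕ) → A) → A
  | 0, _, h, _ => ∑ i, h i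
  | D + 1, R, h, U => contract D (fun k => R k.succ) (rowMul h (U 0)) (fun d => U d.succ)

theorem continuous_rowMul {A : Type*} [CommRing A] [TopologicalSpace A] [IsTopologicalRing A]
    {m k : ℕ} :
    Continuous (fun p : (Fin m → A) × (Fin m × Fin k → A) => rowMul p.1 p.2) := by
  unfold rowMul
  fun_prop

theorem continuous_contract {A : Type*} [CommRing A] [TopologicalSpace A] [IsTopologicalRing A]
    (D : ℕ) (R : Fin (D + 1) → ℕ+) :
    Continuous (fun p : (Fin (R 0 : ℕ) → A) ×
      ((d : Fin D) → Fin (R d.castSucc : ℕ) × Fin (R d.succ : ℕ) → A) =>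
      contract D R p.1 p.2) := by
  induction D with
  | zero => unfold contract; fun_prop
  | succ D ih =>
    unfold contract
    refine (ih fun k => R k.succ).comp (Continuous.prodMk ?_ ?_)
    · exact continuous_rowMul.comp
        (continuous_fst.prodMk ((continuous_apply 0).comp continuous_snd))
    · exact continuous_pi fun d => (continuous_apply d.succ).comp continuous_snd

/-- The sum over all rank indices, as an iterated product of matrices. -/
theorem sum_mul_prod_eq_contract {A : Type*} [CommRing A] (D : ℕ) (R : Fin (D + 1) → ℕ+)
    (h : Fin (R 0 : ℕ) → A)
    (U : (d : Fin D) → Fin (R d.castSucc : ℕ) × Fin (R d.succ : ℕ) → A) :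
    ∑ r : (k : Fin (D + 1)) → Fin (R k : ℕ),
      h (r 0) * ∏ d : Fin D, U d (r d.castSucc, r d.succ) = contract D R h U := by
  induction D with
  | zero =>
    unfold contract
    simp only [Finset.univ_eq_empty, Finset.prod_empty, mul_one]
    exact Fintype.sum_equiv (Equiv.piUnique fun k : Fin 1 => Fin (R k : ℕ)) _ _ fun r => rfl
  | succ D ih =>
    unfold contract
    rw [← ih, ← (Fin.consEquiv fun k => Fin (R k : ℕ)).sum_comp, Fintype.sum_prod_type_right]
    refine Finset.sum_congr rfl fun r _ => ?_
    rw [show rowMul h (U 0) (r 0) = ∑ i, h i * U 0 (i, r 0) from rfl, Finset.sum_mul]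
    refine Finset.sum_congr rfl fun i _ => ?_
    rw [Fin.prod_univ_succ, mul_assoc]
    rfl

end Contraction

/-! ### Laws of tensor trains with independent cores. -/

section Laws

variable {ι : Type*} [Fintype ι]

/-- The law of `c • X` when `ρ` is the law of `X`. -/
noncomputable def scaleLaw (c : ℝ) (ρ : ProbabilityMeasure (ι → ℝ)) :
    ProbabilityMeasure (ι → ℝ) :=
  ρ.map (f := fun x => c • x) (measurable_const_smul c).aemeasurable

/-- The law of `r` independent vectors of law `ρ`, scaled by `r ^ (-1/4)`. -/
noncomputable def iidLaw (r : ℕ+) (ρ : ProbabilityMeasure (ι → ℝ)) :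
    ProbabilityMeasure (Fin (r : ℕ) → ι → ℝ) :=
  ProbabilityMeasure.pi fun _ => scaleLaw (((r : ℝ) ^ (1 / 4 : ℝ))⁻¹) ρ

/-- The law of a core with independent fibers of law `κ`, up to the scaling. -/
noncomputable def coreLaw (r s : ℕ+) (κ : ProbabilityMeasure (ι → ℝ)) :
    ProbabilityMeasure (Fin (r : ℕ) × Fin (s : ℕ) → ι → ℝ) :=
  ProbabilityMeasure.pi fun _ => scaleLaw ((((r : ℝ) * (s : ℝ)) ^ (1 / 4 : ℝ))⁻¹) κ

/-- The law of the product of a random row vector of law `μ` and an independent random core. -/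
noncomputable def stepLaw (r s : ℕ+) (μ : ProbabilityMeasure (Fin (r : ℕ) → ι → ℝ))
    (κ : ProbabilityMeasure (ι → ℝ)) : ProbabilityMeasure (Fin (s : ℕ) → ι → ℝ) :=
  (μ.prod (coreLaw r s κ)).map (f := fun p => rowMul p.1 p.2)
    continuous_rowMul.measurable.aemeasurable

/-- The law of the contraction of a random row vector of law `μ` with independent random cores. -/
noncomputable def ttLaw (D : ℕ) (R : Fin (D + 1) → ℕ+)
    (μ : ProbabilityMeasure (Fin (R 0 : ℕ) → ι → ℝ)) (κ : Fin D → ProbabilityMeasure (ι → ℝ)) :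
    ProbabilityMeasure (ι → ℝ) :=
  (μ.prod (ProbabilityMeasure.pi fun d : Fin D => coreLaw (R d.castSucc) (R d.succ) (κ d))).map
    (f := fun p => contract D R p.1 p.2) (continuous_contract D R).measurable.aemeasurable

/-- Lets a weak limit of the row vector pass through the remaining cores: the product with a fixed
law is weakly continuous, and the contraction is a continuous map. -/
theorem continuous_ttLaw (D : ℕ) (R : Fin (D + 1) → ℕ+)
    (κ : Fin D → ProbabilityMeasure (ι → ℝ)) : Continuous fun μ => ttLaw D R μ κ :=
  (ProbabilityMeasure.continuous_map (continuous_contract D R)).comp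
    (ProbabilityMeasure.continuous_prod.comp (continuous_id.prodMk continuous_const))

theorem measurePreserving_finCons {D : ℕ} {α : Fin (D + 1) → Type*} [∀ d, MeasurableSpace (α d)]
    (η : (d : Fin (D + 1)) → Measure (α d)) [∀ d, IsProbabilityMeasure (η d)] :
    MeasurePreserving (fun p : α 0 × ((d : Fin D) → α d.succ) => (Fin.cons p.1 p.2 : ∀ d, α d))
      ((η 0).prod (Measure.pi fun d => η d.succ)) (Measure.pi η) := by
  have hm : Measurable
      (fun p : α 0 × ((d : Fin D) → α d.succ) => (Fin.cons p.1 p.2 : ∀ d, α d)) := by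
    refine measurable_pi_iff.2 fun d => ?_
    cases d using Fin.cases with
    | zero => exact measurable_fst
    | succ d => exact (measurable_pi_apply d).comp measurable_snd
  refine ⟨hm, (Measure.pi_eq fun s hs => ?_).symm⟩
  rw [Measure.map_apply hm (MeasurableSet.univ_pi hs)]
  have : (fun p : α 0 × ((d : Fin D) → α d.succ) => (Fin.cons p.1 p.2 : ∀ d, α d)) ⁻¹'
      Set.univ.pi s = s 0 ×ˢ Set.univ.pi fun d : Fin D => s d.succ := by
    ext p
    simp [Set.mem_pi, Fin.forall_fin_succ]
  rw [this, Measure.prod_prod, Measure.pi_pi, Fin.prod_univ_succ]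

theorem map_prod_pi_fin_succ {D : ℕ} {α δ γ : Type*} [MeasurableSpace α] [MeasurableSpace δ]
    [MeasurableSpace γ] {β : Fin (D + 1) → Type*} [∀ d, MeasurableSpace (β d)]
    (μ : Measure α) [IsProbabilityMeasure μ] (η : (d : Fin (D + 1)) → Measure (β d))
    [∀ d, IsProbabilityMeasure (η d)] {f : α × (∀ d, β d) → γ} (hf : Measurable f)
    {g : α × β 0 → δ} (hg : Measurable g) {F : δ × ((d : Fin D) → β d.succ) → γ}
    (hF : Measurable F) (h : ∀ a u U, f (a, Fin.cons u U) = F (g (a, u), U)) :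
    (μ.prod (Measure.pi η)).map f =
      (((μ.prod (η 0)).map g).prod (Measure.pi fun d : Fin D => η d.succ)).map F := by
  have : IsProbabilityMeasure ((μ.prod (η 0)).map g) :=
    Measure.isProbabilityMeasure_map hg.aemeasurable
  have h1 := ((hf.measurePreserving _).comp ((MeasurePreserving.id μ).prod
    (measurePreserving_finCons η))).comp
    (measurePreserving_prodAssoc μ (η 0) (Measure.pi fun d : Fin D => η d.succ))
  have h2 := (hF.measurePreserving _).comp ((hg.measurePreserving (μ.prod (η 0))).prod
    (MeasurePreserving.id (Measure.pi fun d : Fin D => η d.succ)))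
  rw [← h1.map_eq, ← h2.map_eq]
  congr 1
  exact funext fun p => h p.1.1 p.1.2 p.2

/-- Absorbing the first core into the row vector. -/
theorem ttLaw_succ (D : ℕ) (R : Fin (D + 1 + 1) → ℕ+)
    (μ : ProbabilityMeasure (Fin (R 0 : ℕ) → ι → ℝ))
    (κ : Fin (D + 1) → ProbabilityMeasure (ι → ℝ)) :
    ttLaw (D + 1) R μ κ =
      ttLaw D (fun k => R k.succ) (stepLaw (R 0) (R (Fin.succ 0)) μ (κ 0))
        (fun d => κ d.succ) := by
  have : ∀ d, IsProbabilityMeasure (coreLaw (R d.castSucc) (R d.succ) (κ d)).toMeasure :=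
    fun d => (coreLaw _ _ (κ d)).2
  have hr : Measurable (fun p : (Fin (R 0 : ℕ) → ι → ℝ) ×
      (Fin (R 0 : ℕ) × Fin (R (Fin.succ 0) : ℕ) → ι → ℝ) => rowMul p.1 p.2) :=
    continuous_rowMul.measurable
  exact Subtype.ext (map_prod_pi_fin_succ μ.toMeasure
    (fun d : Fin (D + 1) => (coreLaw (R d.castSucc) (R d.succ) (κ d)).toMeasure)
    (continuous_contract (D + 1) R).measurable hr
    (continuous_contract D fun k => R k.succ).measurable fun _ _ _ => rfl)

end Laws

/-! ### The central limit step and its iteration. -/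

section Limit

theorem inv_rpow_quarter_sq (x : ℝ) (hx : 0 ≤ x) : ((x ^ (1 / 4 : ℝ))⁻¹) ^ 2 = (√x)⁻¹ := by
  rw [inv_pow, ← Real.rpow_natCast, ← Real.rpow_mul hx, Real.sqrt_eq_rpow]
  norm_num

theorem HasSecondMoments.scaleLaw {ι : Type*} {ρ : ProbabilityMeasure (ι → ℝ)} {C : ι → ι → ℝ}
    (h : HasSecondMoments (ρ : Measure (ι → ℝ)) (fun i x => x i) C) (c : ℝ) :
    HasSecondMoments (scaleLaw c ρ : Measure (ι → ℝ)) (fun i x => x i)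
      (fun i j => c ^ 2 * C i j) :=
  (HasSecondMoments.map_iff (measurable_const_smul c).aemeasurable).2 (h.const_mul c)

variable {ι : Type*} [Fintype ι]

/-- The law of the product of an i.i.d. row vector with a core, in terms of i.i.d. rows of the
core. -/
theorem toMeasure_stepLaw_iidLaw (r s : ℕ+) (ρ κ : ProbabilityMeasure (ι → ℝ)) :
    (stepLaw r s (iidLaw r ρ) κ).toMeasure =
      (Measure.infinitePi fun _ : ℕ =>
        ρ.toMeasure.prod (Measure.pi fun _ : Fin (s : ℕ) => κ.toMeasure)).map
        (fun ω => (√((r : ℕ) : ℝ))⁻¹ • ∑ k ∈ Finset.range (r : ℕ),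
          fun j => ((s : ℝ) ^ (1 / 4 : ℝ))⁻¹ • ((ω k).1 * (ω k).2 j)) := by
  set c : ℝ := ((r : ℝ) ^ (1 / 4 : ℝ))⁻¹
  set d : ℝ := (((r : ℝ) * (s : ℝ)) ^ (1 / 4 : ℝ))⁻¹
  -- The row and the core each contribute `r ^ (-1/4)`; together they give the normalization of the
  -- central limit theorem.
  have hcd : c * d = (√((r : ℕ) : ℝ))⁻¹ * ((s : ℝ) ^ (1 / 4 : ℝ))⁻¹ := by
    rw [← inv_rpow_quarter_sq _ (Nat.cast_nonneg _)]
    simp only [c, d]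
    rw [Real.mul_rpow (Nat.cast_nonneg _) (Nat.cast_nonneg _), mul_inv]
    ring
  -- Measure-preserving maps from the i.i.d. sequence to the contracted row: keep `r` terms,
  -- separate row entries from core rows, uncurry the core, rescale both, multiply.
  have m1 : MeasurePreserving (fun (ω : ℕ → (ι → ℝ) × (Fin (s : ℕ) → ι → ℝ))
      (i : Fin (r : ℕ)) => ω i)
      (Measure.infinitePi fun _ : ℕ =>
        ρ.toMeasure.prod (Measure.pi fun _ : Fin (s : ℕ) => κ.toMeasure))
      (Measure.pi fun _ : Fin (r : ℕ) =>
        ρ.toMeasure.prod (Measure.pi fun _ : Fin (s : ℕ) => κ.toMeasure)) :=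
    ⟨by fun_prop, by
      rw [Measure.map_infinitePi_infinitePi_of_inj (f := fun i : Fin (r : ℕ) => (i : ℕ))
        Fin.val_injective, Measure.infinitePi_eq_pi]⟩
  have m2 := measurePreserving_arrowProdEquivProdArrow (ι → ℝ) (Fin (s : ℕ) → ι → ℝ)
    (Fin (r : ℕ)) (fun _ => ρ.toMeasure) (fun _ => Measure.pi fun _ => κ.toMeasure)
  have m3 : MeasurePreserving (MeasurableEquiv.curry (Fin (r : ℕ)) (Fin (s : ℕ)) (ι → ℝ)).symm
      (Measure.pi fun _ => Measure.pi fun _ => κ.toMeasure) (Measure.pi fun _ => κ.toMeasure) :=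
    ⟨MeasurableEquiv.measurable _, by
      simpa only [Measure.infinitePi_eq_pi] using Measure.infinitePi_map_curry_symm
        (fun (_ : Fin (r : ℕ)) (_ : Fin (s : ℕ)) => κ.toMeasure)⟩
  have m4 : MeasurePreserving (fun (x : Fin (r : ℕ) → ι → ℝ) i => c • x i)
      (Measure.pi fun _ => ρ.toMeasure) (iidLaw r ρ).toMeasure :=
    measurePreserving_pi _ _ fun _ => (measurable_const_smul c).measurePreserving ρ.toMeasure
  have m5 : MeasurePreserving (fun (x : Fin (r : ℕ) × Fin (s : ℕ) → ι → ℝ) i => d • x i)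
      (Measure.pi fun _ => κ.toMeasure) (coreLaw r s κ).toMeasure :=
    measurePreserving_pi _ _ fun _ => (measurable_const_smul d).measurePreserving κ.toMeasure
  have m6 : MeasurePreserving (fun p => rowMul p.1 p.2)
      ((iidLaw r ρ).toMeasure.prod (coreLaw r s κ).toMeasure)
      (stepLaw r s (iidLaw r ρ) κ).toMeasure :=
    continuous_rowMul.measurable.measurePreserving _
  have m7 := m6.comp ((m4.prod (m5.comp m3)).comp (m2.comp m1))
  rw [← m7.map_eq]
  congr 1
  ext ω j k
  have hsum : ∀ f : ℕ → ℝ, ∑ i ∈ Finset.range (r : ℕ), f i = ∑ i : Fin (r : ℕ), f i :=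
    fun f => (Fin.sum_univ_eq_sum_range f _).symm
  simp only [Pi.smul_apply, Finset.sum_apply, Pi.mul_apply, smul_eq_mul]
  rw [hsum, Finset.mul_sum]
  simp only [Function.comp, rowMul, Finset.sum_apply]
  refine Finset.sum_congr rfl fun i _ => ?_
  change (c * (ω i).1 k) * (d * (ω i).2 j k) = _
  rw [show c * (ω i).1 k * (d * (ω i).2 j k) = (c * d) * ((ω i).1 k * (ω i).2 j k) by ring, hcd,
    mul_assoc]

/-- The central limit theorem for one contraction: the product of an i.i.d. row vector with a core
is asymptotically an i.i.d. Gaussian row vector. -/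
theorem tendsto_stepLaw_iidLaw (s : ℕ+) {ρ κ γ : ProbabilityMeasure (ι → ℝ)} {C K : ι → ι → ℝ}
    (hρ : HasSecondMoments ρ.toMeasure (fun i x => x i) C)
    (hκ : HasSecondMoments κ.toMeasure (fun i x => x i) K)
    (hγ : IsGaussian γ.toMeasure)
    (hγC : HasSecondMoments γ.toMeasure (fun i x => x i) (fun i j => C i j * K i j)) :
    Tendsto (fun r : ℕ+ => stepLaw r s (iidLaw r ρ) κ) atTop (𝓝 (iidLaw s γ)) := by
  set c : ℝ := ((s : ℝ) ^ (1 / 4 : ℝ))⁻¹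
  set B := ρ.toMeasure.prod (Measure.pi fun _ : Fin (s : ℕ) => κ.toMeasure)
  set Q := Measure.infinitePi fun _ : ℕ => B
  set Z : (ι → ℝ) × (Fin (s : ℕ) → ι → ℝ) → Fin (s : ℕ) → ι → ℝ :=
    fun p j => c • (p.1 * p.2 j)
  have hZm : Measurable Z := Continuous.measurable (by fun_prop)
  have hsum : ∀ n : ℕ, Measurable (fun ω : ℕ → (ι → ℝ) × (Fin (s : ℕ) → ι → ℝ) =>
      (√(n : ℝ))⁻¹ • ∑ k ∈ Finset.range n, Z (ω k)) := fun n => by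
    have : ∀ k, Measurable (fun ω : ℕ → (ι → ℝ) × (Fin (s : ℕ) → ι → ℝ) => Z (ω k)) :=
      fun k => hZm.comp (measurable_pi_apply k)
    have h := Finset.measurable_fun_sum (Finset.range n) fun k _ => this k
    exact h.const_smul (√(n : ℝ))⁻¹
  have hev : ∀ i : ℕ, MeasurePreserving (fun ω => ω i) Q B :=
    fun i => measurePreserving_eval_infinitePi _ i
  -- Columns `p.1 ≠ q.1` share the factor of law `ρ`, but are uncorrelated because the core entries
  -- are independent and centered.
  have hZC : HasSecondMoments Q (fun (p : Fin (s : ℕ) × ι) ω => Z (ω 0) p.1 p.2)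
      (fun p q => if p.1 = q.1 then c ^ 2 * (C p.2 q.2 * K p.2 q.2) else 0) := by
    have := (((hρ.mul_prod (hκ.pi (κ := Fin (s : ℕ))) Prod.snd).const_mul
      c).comp_measurePreserving (hev 0))
    simp only [mul_ite, mul_zero] at this
    exact this
  have hγG : IsGaussian (scaleLaw c γ).toMeasure :=
    isGaussian_map (μ := γ.toMeasure) (c • ContinuousLinearMap.id ℝ (ι → ℝ))
  have hG : IsGaussian (iidLaw s γ).toMeasure :=
    isGaussian_pi fun _ : Fin (s : ℕ) => (scaleLaw c γ).toMeasure
  have hGC : HasSecondMoments (iidLaw s γ).toMeasure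
      (fun (p : Fin (s : ℕ) × ι) x => x p.1 p.2)
      (fun p q => if p.1 = q.1 then c ^ 2 * (C p.2 q.2 * K p.2 q.2) else 0) :=
    (hγC.scaleLaw c).pi
  have key := tendsto_map_inv_sqrt_smul_sum (P := Q) (X := fun i ω => Z (ω i)) (γ := iidLaw s γ)
    (μ := fun n => ⟨_, Measure.isProbabilityMeasure_map (hsum n).aemeasurable⟩)
    (fun i => hZm.comp (measurable_pi_apply i))
    (iIndepFun_infinitePi fun _ => hZm)
    (fun i => ⟨(hZm.comp (measurable_pi_apply i)).aemeasurable,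
      (hZm.comp (measurable_pi_apply 0)).aemeasurable, by
      rw [← Function.comp_def Z, ← Function.comp_def Z,
        ← Measure.map_map hZm (measurable_pi_apply i),
        ← Measure.map_map hZm (measurable_pi_apply 0), (hev i).map_eq, (hev 0).map_eq]⟩)
    (fun L => by
      obtain ⟨a, ha⟩ := exists_dual_eq_sum_prod L
      rw [ha]
      exact (hZC.linear fun _ : Unit => a).memLp ())
    (fun L => by
      obtain ⟨a, ha⟩ := exists_dual_eq_sum_prod L
      rw [ha]
      exact (hZC.linear fun _ : Unit => a).mean ())
    hG
    (fun L => by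
      obtain ⟨a, ha⟩ := exists_dual_eq_sum_prod L
      rw [ha]
      exact (hGC.linear fun _ : Unit => a).mean ())
    (fun L => by
      obtain ⟨a, ha⟩ := exists_dual_eq_sum_prod L
      rw [ha, hGC.variance_sum a, hZC.variance_sum a])
    (fun n => rfl)
  -- The limit over `ℕ` is restricted to positive ranks.
  refine (key.comp (tendsto_PNat_val_atTop_atTop)).congr fun r => Subtype.ext ?_
  exact (toMeasure_stepLaw_iidLaw r s ρ κ).symm

/-- A tensor train law whose left-most vector is i.i.d. -/
noncomputable def iidTTLaw (D : ℕ) (R : Fin (D + 1) → ℕ+) (ρ : ProbabilityMeasure (ι → ℝ))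
    (κ : Fin D → ProbabilityMeasure (ι → ℝ)) : ProbabilityMeasure (ι → ℝ) :=
  ttLaw D R (iidLaw (R 0) ρ) κ

/-- With no cores left and rank 1, the row has a single entry and its scaling factor is 1. -/
theorem iidTTLaw_zero (R : Fin 1 → ℕ+) (hR : R 0 = 1) (ρ : ProbabilityMeasure (ι → ℝ))
    (κ : Fin 0 → ProbabilityMeasure (ι → ℝ)) : iidTTLaw 0 R ρ κ = ρ := by
  obtain rfl : R = fun _ => 1 := funext fun i => by rw [Subsingleton.elim i 0, hR]
  have h1 : (iidLaw 1 ρ).toMeasure = Measure.pi fun _ : Fin 1 => ρ.toMeasure := by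
    change (Measure.pi fun _ : Fin 1 =>
      ρ.toMeasure.map (fun x => ((((1 : ℕ+) : ℕ) : ℝ) ^ (1 / 4 : ℝ))⁻¹ • x)) = _
    simp
  have h2 : MeasurePreserving (fun x : Fin 1 → ι → ℝ => ∑ i, x i) (iidLaw 1 ρ).toMeasure
      ρ.toMeasure := by
    simp only [Fin.sum_univ_one, h1]
    exact measurePreserving_eval (fun _ : Fin 1 => ρ.toMeasure) 0
  exact Subtype.ext (h2.comp (measurePreserving_fst (ν := (ProbabilityMeasure.pi fun d : Fin 0 =>
    coreLaw 1 1 (κ d)).toMeasure))).map_eq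

theorem tendsto_iidTTLaw (D : ℕ) (S : Fin (D + 1) → ℕ+) {ρ γ : ProbabilityMeasure (ι → ℝ)}
    (κ : Fin (D + 1) → ProbabilityMeasure (ι → ℝ)) {C K : ι → ι → ℝ}
    (hρ : HasSecondMoments ρ.toMeasure (fun i x => x i) C)
    (hκ : HasSecondMoments (κ 0).toMeasure (fun i x => x i) K)
    (hγ : IsGaussian γ.toMeasure)
    (hγC : HasSecondMoments γ.toMeasure (fun i x => x i) (fun i j => C i j * K i j)) :
    Tendsto (fun r : ℕ+ => iidTTLaw (D + 1) (Fin.cons r S) ρ κ) atTop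
      (𝓝 (iidTTLaw D S γ fun d => κ d.succ)) := by
  have := ((continuous_ttLaw D S fun d => κ d.succ).tendsto _).comp
    (tendsto_stepLaw_iidLaw (S 0) hρ hκ hγ hγC)
  exact this.congr fun r => (ttLaw_succ D (Fin.cons r S) (iidLaw r ρ) κ).symm

/-- A probabilistic Schur product theorem: the entrywise product of `C` and `K` is positive
semidefinite, being the covariance of the pointwise product of independent vectors. -/
theorem exists_isGaussian_mul {ρ κ : ProbabilityMeasure (ι → ℝ)} {C K : ι → ι → ℝ}
    (hρ : HasSecondMoments ρ.toMeasure (fun i x => x i) C)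
    (hκ : HasSecondMoments κ.toMeasure (fun i x => x i) K) :
    ∃ γ : ProbabilityMeasure (ι → ℝ), IsGaussian γ.toMeasure ∧
      HasSecondMoments γ.toMeasure (fun i x => x i) (fun i j => C i j * K i j) :=
  exists_isGaussian_hasSecondMoments (hρ.mul_prod hκ id).posSemidef

theorem isSuccessiveLimit_iidTTLaw_succ (n : ℕ) {ρ γ a : ProbabilityMeasure (ι → ℝ)}
    (κ : Fin (n + 1) → ProbabilityMeasure (ι → ℝ)) {C K : ι → ι → ℝ}
    (hρ : HasSecondMoments ρ.toMeasure (fun i x => x i) C)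
    (hκ : HasSecondMoments (κ 0).toMeasure (fun i x => x i) K)
    (hγ : IsGaussian γ.toMeasure)
    (hγC : HasSecondMoments γ.toMeasure (fun i x => x i) (fun i j => C i j * K i j))
    (ha : IsSuccessiveLimit n (fun R : Fin n → ℕ+ =>
      iidTTLaw n (Fin.snoc (α := fun _ => ℕ+) R 1) γ fun d => κ d.succ) a) :
    IsSuccessiveLimit (n + 1)
      (fun R : Fin (n + 1) → ℕ+ =>
        iidTTLaw (n + 1) (Fin.snoc (α := fun _ => ℕ+) R 1) ρ κ) a := by
  -- The intermediate limit, read off from `ha`, is the law of the train with one core fewer.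
  refine ⟨_, fun s => ?_, ha⟩
  refine (tendsto_iidTTLaw n (Fin.snoc (α := fun _ => ℕ+) s 1) κ hρ hκ hγ hγC).congr fun r => ?_
  rw [Fin.cons_snoc_eq_snoc_cons (β := ℕ+)]

/-- Gaussianity of `ρ` serves the base case, where no limit is taken and `ρ` must equal `γ`; each
central limit step restores it. -/
theorem isSuccessiveLimit_iidTTLaw_of_isGaussian (n : ℕ) {ρ γ : ProbabilityMeasure (ι → ℝ)}
    (κ : Fin n → ProbabilityMeasure (ι → ℝ)) {C : ι → ι → ℝ} {K : Fin n → ι → ι → ℝ}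
    (hρG : IsGaussian ρ.toMeasure)
    (hρ : HasSecondMoments ρ.toMeasure (fun i x => x i) C)
    (hκ : ∀ d, HasSecondMoments (κ d).toMeasure (fun i x => x i) (K d))
    (hγ : IsGaussian γ.toMeasure)
    (hγC : HasSecondMoments γ.toMeasure (fun i x => x i) (fun i j => C i j * ∏ d, K d i j)) :
    IsSuccessiveLimit n
      (fun R : Fin n → ℕ+ => iidTTLaw n (Fin.snoc (α := fun _ => ℕ+) R 1) ρ κ) γ := by
  induction n generalizing ρ C with
  | zero =>
    refine (iidTTLaw_zero _ rfl ρ κ).trans (Subtype.ext ?_)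
    refine IsGaussian.eq_of_hasSecondMoments hρG hγ hρ ?_
    simpa using hγC
  | succ n ih =>
    obtain ⟨γ₁, hγ₁, hγ₁C⟩ := exists_isGaussian_mul hρ (hκ 0)
    refine isSuccessiveLimit_iidTTLaw_succ n κ hρ (hκ 0) hγ₁ hγ₁C
      (ih _ hγ₁ hγ₁C (fun d => hκ d.succ) ?_)
    simpa only [Fin.prod_univ_succ, mul_assoc] using hγC

/-- Tensor train laws with at least one inner rank have Gaussian successive limits. -/
theorem isSuccessiveLimit_iidTTLaw (n : ℕ) {ρ γ : ProbabilityMeasure (ι → ℝ)}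
    (κ : Fin (n + 1) → ProbabilityMeasure (ι → ℝ)) {C : ι → ι → ℝ} {K : Fin (n + 1) → ι → ι → ℝ}
    (hρ : HasSecondMoments ρ.toMeasure (fun i x => x i) C)
    (hκ : ∀ d, HasSecondMoments (κ d).toMeasure (fun i x => x i) (K d))
    (hγ : IsGaussian γ.toMeasure)
    (hγC : HasSecondMoments γ.toMeasure (fun i x => x i) (fun i j => C i j * ∏ d, K d i j)) :
    IsSuccessiveLimit (n + 1)
      (fun R : Fin (n + 1) → ℕ+ =>
        iidTTLaw (n + 1) (Fin.snoc (α := fun _ => ℕ+) R 1) ρ κ) γ := by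
  obtain ⟨γ₁, hγ₁, hγ₁C⟩ := exists_isGaussian_mul hρ (hκ 0)
  refine isSuccessiveLimit_iidTTLaw_succ n κ hρ (hκ 0) hγ₁ hγ₁C
    (isSuccessiveLimit_iidTTLaw_of_isGaussian n _ hγ₁ hγ₁C (fun d => hκ d.succ) hγ ?_)
  simpa only [Fin.prod_univ_succ, mul_assoc] using hγC

end Limit

/-! ### From the random cores to tensor train laws. -/

section Machine

/-- The feature map of one mode, at the inputs `x 0, …, x (N - 1)`, applied to a fiber. -/
def fiberEval {N m : ℕ} (ψ : Fin N → Fin m → ℝ) (v : Fin m → ℝ) (k : Fin N) : ℝ :=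
  ∑ i, ψ k i * v i

theorem continuous_fiberEval {N m : ℕ} (ψ : Fin N → Fin m → ℝ) : Continuous (fiberEval ψ) := by
  unfold fiberEval
  fun_prop

theorem fiberEval_smul {N m : ℕ} (ψ : Fin N → Fin m → ℝ) (c : ℝ) (v : Fin m → ℝ) :
    fiberEval ψ (c • v) = c • fiberEval ψ v := by
  ext k
  simp only [fiberEval, Pi.smul_apply, smul_eq_mul, Finset.mul_sum]
  exact Finset.sum_congr rfl fun i _ => by ring

/-- For fixed rank indices, the sum over all multi-indices of modes factors into one sum per mode.
-/
theorem ttMachine_eq_contract {D N : ℕ} {M : Fin D → ℕ} {R : Fin (D + 1) → ℕ+}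
    (φ : (d : Fin D) → ℝ → Fin (M d) → ℝ) (W : TTCores D M R) (x : Fin N → Fin D → ℝ) :
    (fun k => ttMachine φ W (x k)) =
      contract D R 1 fun d p => fiberEval (fun k => φ d (x k d)) (W d p.1 p.2) := by
  rw [← sum_mul_prod_eq_contract]
  ext k
  simp only [ttMachine, frobeniusInner, basisTensor, ttTensor, Finset.mul_sum, Finset.sum_apply,
    Finset.prod_apply, Pi.one_apply, one_mul, fiberEval]
  rw [Finset.sum_comm]
  refine Finset.sum_congr rfl fun r _ => ?_
  simp only [← Finset.prod_mul_distrib]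
  exact (Fintype.prod_sum fun (d : Fin D) (m : Fin (M d)) =>
    φ d (x k d) m * W d (r d.castSucc) (r d.succ) m).symm

/-- The law of the deterministic row vector of ones. -/
noncomputable def onesLaw (ι : Type*) (r : ℕ+) : ProbabilityMeasure (Fin (r : ℕ) → ι → ℝ) :=
  ⟨Measure.dirac 1, inferInstance⟩

theorem toMeasure_stepLaw_onesLaw {ι : Type*} [Fintype ι] (r s : ℕ+)
    (κ : ProbabilityMeasure (ι → ℝ)) :
    (stepLaw r s (onesLaw ι r) κ).toMeasure =
      (coreLaw r s κ).toMeasure.map (fun U => rowMul 1 U) := by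
  change ((Measure.dirac (1 : Fin (r : ℕ) → ι → ℝ)).prod (coreLaw r s κ).toMeasure).map
    (fun p => rowMul p.1 p.2) = _
  rw [Measure.dirac_prod, Measure.map_map continuous_rowMul.measurable (by fun_prop)]
  rfl

/-- A one-row core times the row of ones is that row itself, and `(1 * s) ^ (-1/4)` is exactly the
scaling in `iidLaw s`. -/
theorem stepLaw_onesLaw {ι : Type*} [Fintype ι] (s : ℕ+) (κ : ProbabilityMeasure (ι → ℝ)) :
    stepLaw 1 s (onesLaw ι 1) κ = iidLaw s κ := by
  have h1 : (coreLaw 1 s κ).toMeasure = Measure.pi fun _ : Fin 1 × Fin (s : ℕ) =>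
      (scaleLaw (((s : ℝ) ^ (1 / 4 : ℝ))⁻¹) κ).toMeasure := by
    change (Measure.pi fun _ : Fin 1 × Fin (s : ℕ) =>
      (scaleLaw (((((1 : ℕ+) : ℝ) * (s : ℝ)) ^ (1 / 4 : ℝ))⁻¹) κ).toMeasure) = _
    simp
  have h2 : (fun U : Fin 1 × Fin (s : ℕ) → ι → ℝ => rowMul (1 : Fin 1 → ι → ℝ) U) =
      fun U j => U (0, j) := by
    ext U j
    simp [rowMul]
  apply Subtype.ext
  refine (toMeasure_stepLaw_onesLaw 1 s κ).trans ?_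
  change Measure.map (fun U : Fin 1 × Fin (s : ℕ) → ι → ℝ => rowMul (1 : Fin 1 → ι → ℝ) U) _ =
    Measure.pi fun _ : Fin (s : ℕ) => _
  rw [h1, h2, ← Measure.infinitePi_eq_pi, ← Measure.infinitePi_eq_pi]
  exact Measure.map_infinitePi_infinitePi_of_inj (f := fun j : Fin (s : ℕ) => ((0 : Fin 1), j))
    (Prod.mk_right_injective 0)

theorem ttLaw_ttRanks {ι : Type*} [Fintype ι] {n : ℕ} (R : Fin n → ℕ+)
    (κ : Fin (n + 1) → ProbabilityMeasure (ι → ℝ)) :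
    ttLaw (n + 1) (ttRanks R) (onesLaw ι (ttRanks R 0)) κ =
      iidTTLaw n (Fin.snoc (α := fun _ => ℕ+) R 1) (κ 0) fun d => κ d.succ := by
  rw [ttLaw_succ]
  exact congrArg (fun μ => ttLaw n (Fin.snoc (α := fun _ => ℕ+) R 1) μ fun d => κ d.succ)
    (stepLaw_onesLaw _ _)

variable {D : ℕ} {M : Fin D → ℕ} {R : Fin (D + 1) → ℕ+}
  {Λ : (d : Fin D) → Matrix (Fin (M d)) (Fin (M d)) ℝ} {Ω : Type*} [MeasurableSpace Ω]
  {P : Measure Ω}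
  {W : (d : Fin D) → Fin (R d.castSucc : ℕ) → Fin (R d.succ : ℕ) → Ω → Fin (M d) → ℝ}

theorem IsTTPrior.aemeasurable (h : IsTTPrior Λ P W) (d : Fin D) (i : Fin (R d.castSucc : ℕ))
    (j : Fin (R d.succ : ℕ)) : AEMeasurable (W d i j) P :=
  aemeasurable_pi_lambda _ fun m => (h.memLp d i j m).aestronglyMeasurable.aemeasurable

theorem IsTTPrior.hasSecondMoments (h : IsTTPrior Λ P W) {ν : (d : Fin D) → Measure (Fin (M d) → ℝ)}
    (hν : ∀ d i j, HasLaw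
      (fun ω => ((R d.castSucc : ℝ) * (R d.succ : ℝ)) ^ (1 / 4 : ℝ) • W d i j ω) (ν d) P)
    (d : Fin D) : HasSecondMoments (ν d) (fun i x => x i) fun m m' => Λ d m m' := by
  have i : Fin (R d.castSucc : ℕ) := ⟨0, PNat.pos _⟩
  have j : Fin (R d.succ : ℕ) := ⟨0, PNat.pos _⟩
  rw [← (hν d i j).map_eq, HasSecondMoments.map_iff (hν d i j).aemeasurable]
  have hW : HasSecondMoments P (fun m ω => W d i j ω m) fun m m' =>
      1 / √((R d.castSucc : ℝ) * (R d.succ : ℝ)) * Λ d m m' :=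
    ⟨h.memLp d i j, h.mean_eq_zero d i j, h.second_moment d i j⟩
  have hpos : (0 : ℝ) < (R d.castSucc : ℝ) * (R d.succ : ℝ) :=
    mul_pos (Nat.cast_pos.2 (PNat.pos _)) (Nat.cast_pos.2 (PNat.pos _))
  have := hW.const_mul (((R d.castSucc : ℝ) * (R d.succ : ℝ)) ^ (1 / 4 : ℝ))
  -- The squared rescaling cancels the rank factor of the second moments.
  have hc : (((R d.castSucc : ℝ) * (R d.succ : ℝ)) ^ (1 / 4 : ℝ)) ^ 2 =
      √((R d.castSucc : ℝ) * (R d.succ : ℝ)) := by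
    rw [← inv_inj, ← inv_rpow_quarter_sq _ hpos.le, inv_pow]
  simp only [hc, one_div (√_), mul_inv_cancel_left₀ (Real.sqrt_pos.2 hpos).ne'] at this
  exact this

/-- Independence of all fibers gives a product measure over triples (core, left index, right index);
currying regroups it core by core. -/
theorem IsTTPrior.map_eq_pi [IsProbabilityMeasure P] (h : IsTTPrior Λ P W)
    {ν : (d : Fin D) → Measure (Fin (M d) → ℝ)}
    (hν : ∀ d i j, HasLaw
      (fun ω => ((R d.castSucc : ℝ) * (R d.succ : ℝ)) ^ (1 / 4 : ℝ) • W d i j ω) (ν d) P)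
    {N : ℕ} (ψ : (d : Fin D) → Fin N → Fin (M d) → ℝ) (κ : Fin D → ProbabilityMeasure (Fin N → ℝ))
    (hκ : ∀ d, (κ d).toMeasure = (ν d).map (fiberEval (ψ d))) :
    P.map (fun ω d (p : Fin (R d.castSucc : ℕ) × Fin (R d.succ : ℕ)) =>
      fiberEval (ψ d) (W d p.1 p.2 ω)) =
      Measure.pi fun d => (coreLaw (R d.castSucc) (R d.succ) (κ d)).toMeasure := by
  have hm : ∀ d i j, AEMeasurable (fun ω => fiberEval (ψ d) (W d i j ω)) P := fun d i j =>
    (continuous_fiberEval (ψ d)).measurable.comp_aemeasurable (h.aemeasurable d i j)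
  have hlaw : ∀ d i j, P.map (fun ω => fiberEval (ψ d) (W d i j ω)) =
      (scaleLaw ((((R d.castSucc : ℝ) * (R d.succ : ℝ)) ^ (1 / 4 : ℝ))⁻¹) (κ d)).toMeasure := by
    intro d i j
    have hpos : (0 : ℝ) < ((R d.castSucc : ℝ) * (R d.succ : ℝ)) ^ (1 / 4 : ℝ) :=
      Real.rpow_pos_of_pos
        (mul_pos (Nat.cast_pos.2 (PNat.pos _)) (Nat.cast_pos.2 (PNat.pos _))) _
    change _ = (κ d).toMeasure.map _
    rw [hκ, ← (hν d i j).map_eq,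
      AEMeasurable.map_map_of_aemeasurable (continuous_fiberEval _).measurable.aemeasurable
        (hν d i j).aemeasurable,
      AEMeasurable.map_map_of_aemeasurable (measurable_const_smul _).aemeasurable
        ((continuous_fiberEval _).measurable.comp_aemeasurable (hν d i j).aemeasurable)]
    congr 1
    ext1 ω
    simp only [Function.comp, fiberEval_smul]
    rw [inv_smul_smul₀ hpos.ne']
  have hind := h.indep.comp
    (g := fun (p : (d : Fin D) × (Fin (R d.castSucc : ℕ) × Fin (R d.succ : ℕ))) =>
      fiberEval (ψ p.1)) (fun p => (continuous_fiberEval (ψ p.1)).measurable)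
  have hpi := (iIndepFun_iff_map_fun_eq_pi_map
    (fun p : (d : Fin D) × (Fin (R d.castSucc : ℕ) × Fin (R d.succ : ℕ)) =>
      hm p.1 p.2.1 p.2.2)).1 hind
  simp only [hlaw] at hpi
  have hcurry := Measure.infinitePi_map_piCurry
    (fun (d : Fin D) (_ : Fin (R d.castSucc : ℕ) × Fin (R d.succ : ℕ)) =>
      (scaleLaw ((((R d.castSucc : ℝ) * (R d.succ : ℝ)) ^ (1 / 4 : ℝ))⁻¹) (κ d)).toMeasure)
  simp only [Measure.infinitePi_eq_pi] at hcurry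
  have hmU : AEMeasurable
      (fun ω (p : (d : Fin D) × (Fin (R d.castSucc : ℕ) × Fin (R d.succ : ℕ))) =>
        fiberEval (ψ p.1) (W p.1 p.2.1 p.2.2 ω)) P :=
    aemeasurable_pi_lambda _ fun p => hm p.1 p.2.1 p.2.2
  rw [← hpi, AEMeasurable.map_map_of_aemeasurable (MeasurableEquiv.measurable _).aemeasurable
    hmU] at hcurry
  exact hcurry

theorem IsTTPrior.fddLaw_eq_ttLaw [IsProbabilityMeasure P] (h : IsTTPrior Λ P W)
    (φ : (d : Fin D) → ℝ → Fin (M d) → ℝ) {ν : (d : Fin D) → Measure (Fin (M d) → ℝ)}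
    (hν : ∀ d i j, HasLaw
      (fun ω => ((R d.castSucc : ℝ) * (R d.succ : ℝ)) ^ (1 / 4 : ℝ) • W d i j ω) (ν d) P)
    {N : ℕ} (x : Fin N → Fin D → ℝ) (κ : Fin D → ProbabilityMeasure (Fin N → ℝ))
    (hκ : ∀ d, (κ d).toMeasure = (ν d).map (fiberEval fun k => φ d (x k d))) :
    fddLaw P (fun y ω => ttMachine φ (fun d i j => W d i j ω) y) (h.aemeasurable_ttMachine φ) x =
      ttLaw D R (onesLaw (Fin N) (R 0)) κ := by
  apply Subtype.ext
  change P.map (fun ω k => ttMachine φ (fun d i j => W d i j ω) (x k)) =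
    ((Measure.dirac (1 : Fin (R 0 : ℕ) → Fin N → ℝ)).prod (Measure.pi fun d : Fin D =>
      (coreLaw (R d.castSucc) (R d.succ) (κ d)).toMeasure)).map (fun p => contract D R p.1 p.2)
  rw [Measure.dirac_prod, Measure.map_map (continuous_contract D R).measurable (by fun_prop),
    ← h.map_eq_pi hν (fun d k => φ d (x k d)) κ hκ,
    AEMeasurable.map_map_of_aemeasurable]
  · congr 1
    ext1 ω
    exact ttMachine_eq_contract φ (fun d i j => W d i j ω) x
  · exact ((continuous_contract D R).measurable.comp measurable_prodMk_left).aemeasurable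
  · exact aemeasurable_pi_lambda _ fun d => aemeasurable_pi_lambda _ fun p =>
      (continuous_fiberEval _).measurable.comp_aemeasurable (h.aemeasurable d _ _)

end Machine

/-! ### The limiting Gaussian process and the conclusion. -/

section GaussianLimit

variable {D : ℕ} {M : Fin D → ℕ}

open scoped MatrixOrder Matrix.Norms.L2Operator in
/-- A centered Gaussian process with the product kernel as its covariance. -/
theorem exists_isGaussianProcess_productKernel (φ : (d : Fin D) → ℝ → Fin (M d) → ℝ)
    {Λ : (d : Fin D) → Matrix (Fin (M d)) (Fin (M d)) ℝ} (hΛ : ∀ d, (Λ d).PosSemidef) :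
    ∃ (Ω' : Type) (_ : MeasurableSpace Ω') (P' : Measure Ω') (_ : IsProbabilityMeasure P')
      (Y : (Fin D → ℝ) → Ω' → ℝ), IsGaussianProcess Y P' ∧
      (∀ (N : ℕ) (x : Fin N → Fin D → ℝ), IsGaussian (P'.map fun ω k => Y (x k) ω)) ∧
      HasSecondMoments P' Y (productKernel φ Λ) := by
  -- Writing `Λ d = Bᵀ B` turns the kernel into an inner product of the rank-one tensors `a x = ⨂ B
  -- d φ d (x d)`; the process is then `a x` paired with a standard Gaussian tensor.
  have hfac : ∀ d, ∃ B : Matrix (Fin (M d)) (Fin (M d)) ℝ, Λ d = B.transpose * B := fun d =>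
    CStarAlgebra.nonneg_iff_eq_star_mul_self.1 (hΛ d).nonneg
  choose B hB using hfac
  obtain ⟨γ, hγ, hγC⟩ := exists_isGaussian_hasSecondMoments (ι := (d : Fin D) → Fin (M d))
    (C := fun i j => (1 : Matrix _ _ ℝ) i j) Matrix.PosSemidef.one
  let a : (Fin D → ℝ) → ((d : Fin D) → Fin (M d)) → ℝ := fun x m =>
    ∏ d, (B d).mulVec (φ d (x d)) (m d)
  have hG : ∀ {T : Type} [Fintype T] (t : T → Fin D → ℝ),
      IsGaussian (γ.toMeasure.map fun ω (k : T) => ∑ m, a (t k) m * ω m) := by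
    intro T _ t
    let L : (((d : Fin D) → Fin (M d)) → ℝ) →L[ℝ] T → ℝ := ContinuousLinearMap.pi fun k =>
      ∑ m, a (t k) m • ContinuousLinearMap.proj (R := ℝ) (φ := fun _ => ℝ) m
    have hL : (L : (((d : Fin D) → Fin (M d)) → ℝ) → T → ℝ) =
        fun ω k => ∑ m, a (t k) m * ω m := by
      ext ω k
      simp [L]
    exact hL ▸ isGaussian_map (μ := γ.toMeasure) L
  refine ⟨_, _, γ.toMeasure, inferInstance, fun x ω => ∑ m, a x m * ω m, ⟨fun I => ⟨hG _⟩⟩,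
    fun N x => hG x, ?_⟩
  convert hγC.linear a using 3 with x x'
  simp only [Matrix.one_apply, mul_ite, mul_one, mul_zero, Finset.sum_ite_eq, Finset.mem_univ,
    if_true, productKernel, a, ← Finset.prod_mul_distrib]
  rw [← Fintype.prod_sum fun (d : Fin D) (m : Fin (M d)) =>
    (B d).mulVec (φ d (x d)) m * (B d).mulVec (φ d (x' d)) m]
  refine Finset.prod_congr rfl fun d _ => ?_
  rw [hB d, ← Matrix.mulVec_mulVec, Matrix.dotProduct_mulVec, Matrix.vecMul_transpose]
  rfl

end GaussianLimit

theorem theorem2 {n : ℕ} (hn : 1 ≤ n) (M : Fin (n + 1) → ℕ)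
    (φ : (d : Fin (n + 1)) → ℝ → Fin (M d) → ℝ)
    (Λ : (d : Fin (n + 1)) → Matrix (Fin (M d)) (Fin (M d)) ℝ)
    (ν : (d : Fin (n + 1)) → Measure (Fin (M d) → ℝ))
    {Ω : (Fin n → ℕ+) → Type*} [∀ R, MeasurableSpace (Ω R)]
    (P : (R : Fin n → ℕ+) → Measure (Ω R)) [∀ R, IsProbabilityMeasure (P R)]
    (W : (R : Fin n → ℕ+) → (d : Fin (n + 1)) → Fin (ttRanks R d.castSucc : ℕ) →
      Fin (ttRanks R d.succ : ℕ) → Ω R → Fin (M d) → ℝ)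
    (hW : ∀ R, IsTTPrior (R := ttRanks R) Λ (P R) (W R))
    -- up to the prescribed scaling, the law of the fibers does not depend on the ranks
    (hν : ∀ R d i j, HasLaw
      (fun ω => ((ttRanks R d.castSucc : ℝ) * (ttRanks R d.succ : ℝ)) ^ (1 / 4 : ℝ) • W R d i j ω)
      (ν d) (P R)) :
    ∃ (Ω' : Type) (_ : MeasurableSpace Ω') (P' : Measure Ω') (_ : IsProbabilityMeasure P')
      (Y : (Fin (n + 1) → ℝ) → Ω' → ℝ) (hY : IsGaussianProcess Y P'),
      (∀ x, ∫ ω, Y x ω ∂P' = 0) ∧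
      (∀ x x', cov[Y x, Y x'; P'] = productKernel φ Λ x x') ∧
      ∀ (N : ℕ) (x : Fin N → Fin (n + 1) → ℝ),
        IsSuccessiveLimit n
          (fun R => fddLaw (P R) (fun y ω => ttMachine φ (fun d i j => W R d i j ω) y)
            ((hW R).aemeasurable_ttMachine φ) x)
          (fddLaw P' Y hY.aemeasurable x) := by
  obtain ⟨n, rfl⟩ : ∃ k, n = k + 1 := ⟨n - 1, by omega⟩
  -- Any ranks would do here, since `ν` does not depend on them.
  have hνC : ∀ d, HasSecondMoments (ν d) (fun i x => x i) fun m m' => Λ d m m' :=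
    (hW fun _ => 1).hasSecondMoments (hν _)
  have hνP : ∀ d, IsProbabilityMeasure (ν d) := fun d => by
    rw [← (hν (fun _ => 1) d ⟨0, PNat.pos _⟩ ⟨0, PNat.pos _⟩).map_eq]
    exact Measure.isProbabilityMeasure_map (hν _ _ _ _).aemeasurable
  obtain ⟨Ω', _, P', _, Y, hY, hYG, hYC⟩ :=
    exists_isGaussianProcess_productKernel φ (Λ := Λ) fun d => (hνC d).posSemidef
  refine ⟨Ω', _, P', ‹_›, Y, hY, hYC.mean, fun x x' => ?_, fun N x => ?_⟩
  · rw [covariance_eq_sub (hYC.memLp x) (hYC.memLp x'), hYC.mean, hYC.mean, mul_zero, sub_zero]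
    exact hYC.second x x'
  · let κ : Fin (n + 1 + 1) → ProbabilityMeasure (Fin N → ℝ) := fun d =>
      ⟨(ν d).map (fiberEval fun k => φ d (x k d)),
        Measure.isProbabilityMeasure_map (continuous_fiberEval _).measurable.aemeasurable⟩
    have hκ : ∀ d, HasSecondMoments (κ d).toMeasure (fun i x => x i) fun k l =>
        φ d (x k d) ⬝ᵥ (Λ d).mulVec (φ d (x l d)) := fun d => by
      refine (HasSecondMoments.map_iff (continuous_fiberEval _).measurable.aemeasurable).2 ?_
      refine cast (congrArg (HasSecondMoments _ _) ?_) ((hνC d).linear fun k => φ d (x k d))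
      ext k l
      simp only [dotProduct, Matrix.mulVec, Finset.mul_sum]
      exact Finset.sum_congr rfl fun i _ => Finset.sum_congr rfl fun j _ => by ring
    have hF : (fun R => fddLaw (P R) (fun y ω => ttMachine φ (fun d i j => W R d i j ω) y)
        ((hW R).aemeasurable_ttMachine φ) x) = fun R : Fin (n + 1) → ℕ+ =>
          iidTTLaw (n + 1) (Fin.snoc (α := fun _ => ℕ+) R 1) (κ 0) fun d => κ d.succ :=
      funext fun R => ((hW R).fddLaw_eq_ttLaw φ (hν R) x κ fun _ => rfl).trans (ttLaw_ttRanks R κ)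
    rw [hF]
    refine isSuccessiveLimit_iidTTLaw n _ (hκ 0) (fun d => hκ d.succ) (hYG N x) ?_
    have hYm : AEMeasurable (fun ω k => Y (x k) ω) P' :=
      aemeasurable_pi_lambda _ fun k => hY.aemeasurable (x k)
    refine (HasSecondMoments.map_iff hYm).2 ⟨fun k => hYC.memLp _, fun k => hYC.mean _,
      fun k l => ?_⟩
    -- The factor of the first mode is the covariance of the initial row; the others come from the
    -- `n + 1` remaining cores.
    rw [hYC.second, productKernel, Fin.prod_univ_succ]
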